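/- **Proposition (Submodularity when users are fixed).** Let $\mathcal U_0=\{1,\dots,U\}$ be a finite set of users and $\mathcal C_0=\{1,\dots,C\}$ a finite set of content creators. User $i$ has a type $u_i\in\mathbb R^D_{\ge 0}$ and creator $j$ a type $c_j\in\mathbb R^D_{\ge 0}$, all of Euclidean norm $1$. Let $K$ be the number of recommendations per user, $\bar e\in[0,1]$ the user constraint and $\bar a\in\mathbb N_0$ the creator constraint. For $\mathcal U\subseteq\mathcal U_0$ and $\mathcal C\subseteq\mathcal C_0$, call $(\mathcal U,\mathcal C)$ a stable set with recommendations $R$ (for $K$ recommendations per user) if $R$ assigns to every $i\in\mathcal U$ a set $R(i)\subseteq\mathcal C$ such that $$|R(i)|=K\ \ \forall i\in\mathcal U,\qquad u_i^Tc_j\ge\bar e\ \ \forall i\in\mathcal U,\ j\in R(i),\qquad |\{i\in\mathcal U: j\in R(i)\}|\ge\bar a\ \ \forall j\in\mathcal C,$$ and define its total engagement as $\sum_{i\in\mathcal U}\sum_{j\in R(i)}u_i^Tc_j$. If $|\mathcal C|\ge K$, let $f(\mathcal U,\mathcal C)$ be the maximum total engagement over all recommendations $R$ with which $(\mathcal U,\mathcal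 C)$ is a stable set. If $|\mathcal C|<K$, let $f(\mathcal U,\mathcal C)$ be the same maximum in the modified instance where each user receives $|\mathcal C|$ recommendations instead of $K$. In either case $f(\mathcal U,\mathcal C)$ is well-defined if and only if at least one such $R$ exists. Suppose $\bar e=0$. Then for all $\mathcal U\subseteq\mathcal U_0$, all distinct $c_0,c_1\in\mathcal C_0$ and all $\mathcal C\subseteq\mathcal C_0\setminus\{c_0,c_1\}$, $$f(\mathcal U,\mathcal C\cup\{c_0,c_1\})-f(\mathcal U,\mathcal C\cup\{c_1\})\ \le\ f(\mathcal U,\mathcal C\cup\{c_0\})-f(\mathcal U,\mathcal C),$$ whenever all four terms are well-defined. This holds for every value of $K$. -/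

import Mathlib

/-- A content platform with initial users `Fin U`, initial creators `Fin C` and types in `ℝ^D`. -/
structure Platform (U C D : ℕ) where
  /-- type vector `u_i` of user `i` -/
  userType : Fin U → EuclideanSpace ℝ (Fin D)
  /-- type vector `c_j` of creator `j` -/
  creatorType : Fin C → EuclideanSpace ℝ (Fin D)
  userType_nonneg : ∀ i d, 0 ≤ userType i d
  creatorType_nonneg : ∀ j d, 0 ≤ creatorType j d
  norm_userType : ∀ i, ‖userType i‖ = 1
  norm_creatorType : ∀ j, ‖creatorType j‖ = 1
  /-- lower bound in the user constraints -/
  ebar : ℝ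
  ebar_mem : ebar ∈ Set.Icc (0 : ℝ) 1
  /-- audience threshold in the creator constraints -/
  abar : ℕ
  /-- number of recommendations per user -/
  K : ℕ

namespace Platform

variable {U C D : ℕ}

/-- The same instance, except that every user receives `k` recommendations. -/
def withRecommendationCount (P : Platform U C D) (k : ℕ) : Platform U C D :=
  { P with K := k }

/-- Engagement `u_iᵀ c_j` of user `i` with creator `j`. -/
noncomputable def pairEngagement (P : Platform U C D) (i : Fin U) (j : Fin C) : ℝ :=
  inner ℝ (P.userType i) (P.creatorType j)

/-- Total engagement of the users in `users` under the recommendations `R`.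
Only the values `R i` with `i ∈ users` matter. -/
noncomputable def engagement (P : Platform U C D) (users : Finset (Fin U))
    (R : Fin U → Finset (Fin C)) : ℝ :=
  ∑ i ∈ users, ∑ j ∈ R i, P.pairEngagement i j

/-- `(users, creators)` is a stable set with recommendations `R`: `R` assigns creators in
`creators` to the users in `users`, and all participation constraints of the players in
`users` and `creators` hold. -/
structure IsStableSet (P : Platform U C D) (users : Finset (Fin U))
    (creators : Finset (Fin C)) (R : Fin U → Finset (Fin C)) : Prop where
  subset : ∀ i ∈ users, R i ⊆ creators
  card_eq : ∀ i ∈ users, (R i).card = P.K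
  happy : ∀ i ∈ users, ∀ j ∈ R i, P.ebar ≤ P.pairEngagement i j
  audience : ∀ j ∈ creators, P.abar ≤ (users.filter fun i => j ∈ R i).card

/-- The instance used to evaluate `f users creators`: the given instance if there are at least
`K` creators, and otherwise the one where every user receives `|creators|` recommendations. -/
def effective (P : Platform U C D) (creators : Finset (Fin C)) : Platform U C D :=
  if P.K ≤ creators.card then P else P.withRecommendationCount creators.card

/-- The total engagements of all recommendations under which `(users, creators)` is a stable
set of the effective instance. -/
def stableEngagements (P : Platform U C D) (users : Finset (Fin U))
    (creators : Finset (Fin C)) : Set ℝ :=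
  {e | ∃ R : Fin U → Finset (Fin C), (P.effective creators).IsStableSet users creators R ∧
    e = (P.effective creators).engagement users R}

/-- `f users creators` is well-defined: there is something to maximize over. -/
def IsWellDefined (P : Platform U C D) (users : Finset (Fin U))
    (creators : Finset (Fin C)) : Prop :=
  ∃ R : Fin U → Finset (Fin C), (P.effective creators).IsStableSet users creators R

/-- The maximum engagement of a stable set whose players are exactly `users` and `creators`
(see `f_isGreatest`: whenever it is well-defined, the supremum is an attained maximum). -/
noncomputable def f (P : Platform U C D) (users : Finset (Fin U))
    (creators : Finset (Fin C)) : ℝ :=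
  sSup (P.stableEngagements users creators)

theorem f_isGreatest (P : Platform U C D) (users : Finset (Fin U))
    (creators : Finset (Fin C)) (h : P.IsWellDefined users creators) :
    IsGreatest (P.stableEngagements users creators) (P.f users creators) := by
  have hfin : (P.stableEngagements users creators).Finite := by
    refine (Set.finite_range
      (fun R : Fin U → Finset (Fin C) => (P.effective creators).engagement users R)).subset ?_
    rintro e ⟨R, -, rfl⟩
    exact ⟨R, rfl⟩
  have hne : (P.stableEngagements users creators).Nonempty := by
    obtain ⟨R, hR⟩ := h
    exact ⟨_, R, hR, rfl⟩
  exact ⟨hne.csSup_mem hfin, fun e he => le_csSup hfin.bddAbove he⟩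

end Platform

/-! If `creators` has at least `K` elements, take optimal `R` on `creators ∪ {c₀, c₁}` and `S` on
`creators`. For each user, match `R i \ S i` with `S i \ R i`; each matched pair is an arc between
creators. Flipping in `R` the arcs on trails that start at `c₁` gives `A`, and the opposite flips in
`S` give `B`. This removes `c₁` from `A` and `c₀` from `B`, keeps all audiences large enough, and
preserves the sum of engagements (`exists_arcs_netInflow_le`, `exists_alternating_exchange`,
`IsStableSet.exists_exchange`). With fewer than `K` creators, `f` is additive up to size `K`, and
one more creator can only lose against additivity. -/

/-! ### Trails in a directed multigraph -/

theorem Finset.exists_bijOn_range_card {α : Type*} (X : Finset α) :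
    ∃ p : α → ℕ, Set.InjOn p X ∧ X.image p = Finset.range X.card := by
  classical
  refine ⟨fun a => if h : a ∈ X then X.equivFin ⟨a, h⟩ else 0, ?_, ?_⟩
  · intro a ha b hb hab
    rw [Finset.mem_coe] at ha hb
    simp only [ha, hb, dite_true] at hab
    exact congrArg Subtype.val (X.equivFin.injective (Fin.ext hab))
  · ext n
    simp only [Finset.mem_image, Finset.mem_range]
    constructor
    · rintro ⟨a, ha, rfl⟩
      simp only [ha, dite_true]
      exact Fin.is_lt _
    · intro hn
      refine ⟨X.equivFin.symm ⟨n, hn⟩, Subtype.prop _, ?_⟩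
      simp

/-- In a finite directed multigraph with arc set `E`, some set `F` of arcs contains all arcs
leaving `c`, and at every other vertex it has a nonnegative net inflow, which does not exceed the
positive part of the net inflow of `E`. -/
theorem exists_arcs_netInflow_le {α V : Type*} [DecidableEq V] (E : Finset α)
    (src tgt : α → V) (c : V) :
    ∃ F ⊆ E, (∀ e ∈ E, src e = c → e ∈ F) ∧ ∀ v ≠ c,
      (F.filter fun e => src e = v).card ≤ (F.filter fun e => tgt e = v).card ∧
      (F.filter fun e => tgt e = v).card - (F.filter fun e => src e = v).card ≤
        (E.filter fun e => tgt e = v).card - (E.filter fun e => src e = v).card := by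
  classical
  choose p hp hp' using fun v => (E.filter fun e => tgt e = v).exists_bijOn_range_card
  choose q hq hq' using fun v => (E.filter fun e => src e = v).exists_bijOn_range_card
  -- At each vertex the `n`-th incoming arc continues into the `n`-th outgoing one, which splits the
  -- arcs into trails. `F` collects what is reachable from arcs leaving `c`.
  let next : α → α → Prop := fun e e' =>
    e' ∈ E ∧ tgt e = src e' ∧ p (tgt e) e = q (tgt e) e'
  let F := E.filter fun e => ∃ s ∈ E, src s = c ∧ Relation.ReflTransGen next s e
  have hFE : F ⊆ E := Finset.filter_subset _ _
  have hclosed : ∀ e ∈ F, ∀ e', next e e' → e' ∈ F := by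
    intro e he e' hn
    obtain ⟨-, s, hs, hsc, hr⟩ := Finset.mem_filter.1 he
    exact Finset.mem_filter.2 ⟨hn.1, s, hs, hsc, hr.tail hn⟩
  have hpred : ∀ e ∈ F, src e ≠ c → ∃ d ∈ F, next d e := by
    intro e he hec
    obtain ⟨-, s, hs, hsc, hr⟩ := Finset.mem_filter.1 he
    rcases Relation.ReflTransGen.cases_tail hr with h | ⟨d, hsd, hde⟩
    · exact absurd (h ▸ hsc) hec
    · refine ⟨d, Finset.mem_filter.2 ⟨?_, s, hs, hsc, hsd⟩, hde⟩
      rcases Relation.ReflTransGen.cases_tail hsd with h | ⟨b, -, hbd⟩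
      · exact h ▸ hs
      · exact hbd.1
  refine ⟨F, hFE, fun e he hc => Finset.mem_filter.2 ⟨he, e, he, hc, .refl⟩, fun v hv => ?_⟩
  set I := F.filter fun e => tgt e = v
  set O := F.filter fun e => src e = v
  have hIE : I ⊆ E.filter fun e => tgt e = v := Finset.filter_subset_filter _ hFE
  have hOE : O ⊆ E.filter fun e => src e = v := Finset.filter_subset_filter _ hFE
  have hI : (I.image (p v)).card = I.card :=
    Finset.card_image_of_injOn ((hp v).mono (Finset.coe_subset.2 hIE))
  have hO : (O.image (q v)).card = O.card :=
    Finset.card_image_of_injOn ((hq v).mono (Finset.coe_subset.2 hOE))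
  -- Away from `c`, an arc of `F` has a predecessor in `F` with the same index.
  have hsub : O.image (q v) ⊆ I.image (p v) := by
    intro n hn
    obtain ⟨e, he, rfl⟩ := Finset.mem_image.1 hn
    obtain ⟨heF, rfl⟩ := Finset.mem_filter.1 he
    obtain ⟨d, hd, -, h1, h2⟩ := hpred e heF hv
    rw [h1] at h2
    exact Finset.mem_image.2 ⟨d, Finset.mem_filter.2 ⟨hd, h1⟩, h2⟩
  refine ⟨by rw [← hI, ← hO]; exact Finset.card_le_card hsub, ?_⟩
  rw [← hI, ← hO, ← Finset.card_sdiff_of_subset hsub]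
  -- A trail ends at `v` only if its index has no outgoing partner; truncated subtraction then
  -- yields the positive part.
  have hdiff : I.image (p v) \ O.image (q v) ⊆
      Finset.Ico (E.filter fun e => src e = v).card (E.filter fun e => tgt e = v).card := by
    intro n hn
    obtain ⟨hnI, hnO⟩ := Finset.mem_sdiff.1 hn
    have hlt : n < (E.filter fun e => tgt e = v).card := by
      rw [← Finset.mem_range, ← hp' v]
      exact Finset.image_subset_image hIE hnI
    refine Finset.mem_Ico.2 ⟨?_, hlt⟩
    by_contra! hlt'
    rw [← Finset.mem_range, ← hq' v] at hlt'
    obtain ⟨e', he', rfl⟩ := Finset.mem_image.1 hlt'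
    obtain ⟨he'E, hsrc⟩ := Finset.mem_filter.1 he'
    obtain ⟨e, he, hee⟩ := Finset.mem_image.1 hnI
    obtain ⟨heF, htgt⟩ := Finset.mem_filter.1 he
    refine hnO (Finset.mem_image.2 ⟨e', Finset.mem_filter.2 ⟨hclosed e heF e' ?_, hsrc⟩, rfl⟩)
    exact ⟨he'E, htgt.trans hsrc.symm, by rw [htgt]; exact hee⟩
  exact (Finset.card_le_card hdiff).trans (by simp)

/-! ### Exchange between two assignments -/

theorem Finset.exists_bijOn_of_card_eq {β : Type*} [DecidableEq β] (X Y : Finset β)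
    (h : X.card = Y.card) : ∃ σ : β → β, Set.InjOn σ X ∧ X.image σ = Y := by
  let e := Finset.equivOfCardEq h
  refine ⟨fun a => if h : a ∈ X then e ⟨a, h⟩ else a, ?_, ?_⟩
  · intro a ha b hb hab
    rw [Finset.mem_coe] at ha hb
    simp only [ha, hb, dite_true] at hab
    exact congrArg Subtype.val (e.injective (Subtype.ext hab))
  · ext y
    simp only [Finset.mem_image]
    constructor
    · rintro ⟨a, ha, rfl⟩
      simp only [ha, dite_true]
      exact Subtype.prop _
    · intro hy
      refine ⟨e.symm ⟨y, hy⟩, Subtype.prop _, ?_⟩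
      simp

theorem Finset.card_sdiff_union_add_card {α : Type*} [DecidableEq α] {X G H : Finset α}
    (hG : G ⊆ X) (hH : Disjoint X H) :
    ((X \ G) ∪ H).card + G.card = X.card + H.card := by
  rw [Finset.card_union_of_disjoint (hH.mono_left Finset.sdiff_subset),
    ← Finset.card_sdiff_add_card_eq_card hG]
  omega

/-- Exchange along alternating paths between two assignments `R` and `S` of sets of equal size. -/
theorem exists_alternating_exchange {α β : Type*} [DecidableEq α] [DecidableEq β]
    (users : Finset α) (R S : α → Finset β) (hcard : ∀ i ∈ users, (R i).card = (S i).card)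
    (c : β) :
    ∃ A B : α → Finset β, (∀ i ∈ users, (A i).card = (R i).card) ∧
      (∀ i ∈ users, A i ∪ B i = R i ∪ S i) ∧ (∀ i ∈ users, A i ∩ B i = R i ∩ S i) ∧
      (∀ i ∈ users, c ∉ S i → c ∉ A i) ∧
      ∀ j ≠ c, (users.filter fun i => j ∈ R i).card ≤ (users.filter fun i => j ∈ A i).card ∧
        (users.filter fun i => j ∈ A i).card ≤
          max (users.filter fun i => j ∈ R i).card (users.filter fun i => j ∈ S i).card := by
  have hsd : ∀ i, ∃ σ : β → β, i ∈ users →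
      Set.InjOn σ (R i \ S i : Finset β) ∧ (R i \ S i).image σ = S i \ R i := by
    intro i
    by_cases hi : i ∈ users
    · obtain ⟨σ, h⟩ := Finset.exists_bijOn_of_card_eq (R i \ S i) (S i \ R i)
        (Finset.card_sdiff_comm (hcard i hi))
      exact ⟨σ, fun _ => h⟩
    · exact ⟨id, fun h => absurd h hi⟩
  choose σ hσ using hsd
  -- The pair `⟨i, j⟩` is the arc from `j` to `σ i j`; recording `i` allows parallel arcs.
  let E : Finset (Σ _ : α, β) := users.sigma fun i => R i \ S i
  obtain ⟨F, hFE, hFc, hF⟩ := exists_arcs_netInflow_le E (fun e => e.2) (fun e => σ e.1 e.2) c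
  let G : α → Finset β := fun i => (R i \ S i).filter fun j => (⟨i, j⟩ : Σ _ : α, β) ∈ F
  let H : α → Finset β := fun i => (G i).image (σ i)
  have hGR : ∀ i, G i ⊆ R i \ S i := fun i => Finset.filter_subset _ _
  have hHS : ∀ i ∈ users, H i ⊆ S i \ R i := fun i hi =>
    (Finset.image_subset_image (hGR i)).trans (hσ i hi).2.subset
  have hsrc : ∀ T ⊆ E, ∀ j, (T.filter fun e => e.2 = j).card =
      (users.filter fun i => j ∈ R i \ S i ∧ (⟨i, j⟩ : Σ _ : α, β) ∈ T).card := by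
    intro T hT j
    refine Finset.card_nbij' (fun e => e.1) (fun i => ⟨i, j⟩) ?_ ?_ ?_ ?_
    · rintro ⟨i, k⟩ h
      simp only [Finset.coe_filter, Set.mem_ofPred_eq] at h ⊢
      obtain ⟨h, rfl⟩ := h
      exact ⟨(Finset.mem_sigma.1 (hT h)).1, (Finset.mem_sigma.1 (hT h)).2, h⟩
    · intro i h
      simp only [Finset.coe_filter, Set.mem_ofPred_eq] at h ⊢
      exact ⟨h.2.2, trivial⟩
    · rintro ⟨i, k⟩ h
      simp only [Finset.coe_filter, Set.mem_ofPred_eq] at h ⊢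
      rw [h.2]
    · intro i _
      rfl
  have htgt : ∀ T ⊆ E, ∀ j, (T.filter fun e => σ e.1 e.2 = j).card =
      (users.filter fun i =>
        j ∈ ((R i \ S i).filter fun k => (⟨i, k⟩ : Σ _ : α, β) ∈ T).image (σ i)).card := by
    intro T hT j
    refine Finset.card_nbij (fun e => e.1) ?_ ?_ ?_
    · rintro ⟨i, k⟩ h
      simp only [Finset.coe_filter, Set.mem_ofPred_eq, Finset.mem_image, Finset.mem_filter] at h ⊢
      have := Finset.mem_sigma.1 (hT h.1)
      exact ⟨this.1, k, ⟨this.2, h.1⟩, h.2⟩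
    · rintro ⟨i, k⟩ h ⟨i', k'⟩ h' hii
      simp only [Finset.coe_filter, Set.mem_ofPred_eq] at h h' hii
      subst hii
      have hk := Finset.mem_sigma.1 (hT h.1)
      have hk' := Finset.mem_sigma.1 (hT h'.1)
      exact congrArg (Sigma.mk i) ((hσ i hk.1).1 hk.2 hk'.2 (h.2.trans h'.2.symm))
    · intro i h
      simp only [Finset.coe_filter, Set.mem_ofPred_eq, Finset.mem_image, Finset.mem_filter] at h
      obtain ⟨-, k, ⟨-, hkT⟩, hk⟩ := h
      exact ⟨⟨i, k⟩, by simpa using ⟨hkT, hk⟩, rfl⟩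
  have hEsrc : ∀ j, (E.filter fun e => e.2 = j).card =
      (users.filter fun i => j ∈ R i \ S i).card := by
    intro j
    rw [hsrc E subset_rfl]
    congr 1
    refine Finset.filter_congr fun i hi => ?_
    simp [E, hi]
  have hEtgt : ∀ j, (E.filter fun e => σ e.1 e.2 = j).card =
      (users.filter fun i => j ∈ S i \ R i).card := by
    intro j
    rw [htgt E subset_rfl]
    congr 1
    refine Finset.filter_congr fun i hi => ?_
    rw [← (hσ i hi).2, Finset.filter_true_of_mem]
    exact fun k hk => Finset.mem_sigma.2 ⟨hi, hk⟩
  have hFsrc : ∀ j, (F.filter fun e => e.2 = j).card = (users.filter fun i => j ∈ G i).card := by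
    intro j
    rw [hsrc F hFE]
    simp only [G, Finset.mem_filter]
  -- Arcs of `F` have sources `G i` and targets `H i`, so the audience of `j` in `A` grows by the
  -- net inflow of `F` at `j`.
  refine ⟨fun i => (R i \ G i) ∪ H i, fun i => (S i \ H i) ∪ G i, ?_, ?_, ?_, ?_, ?_⟩
  · intro i hi
    have h1 := Finset.card_sdiff_union_add_card (X := R i) (G := G i) (H := H i)
      ((hGR i).trans Finset.sdiff_subset)
      (Finset.disjoint_sdiff.mono_right (hHS i hi))
    dsimp only
    have h2 : (H i).card = (G i).card :=
      Finset.card_image_of_injOn ((hσ i hi).1.mono (Finset.coe_subset.2 (hGR i)))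
    omega
  · intro i hi
    ext j
    have h1 := @hGR i j
    have h2 := @hHS i hi j
    simp only [Finset.mem_union, Finset.mem_sdiff] at *
    tauto
  · intro i hi
    ext j
    have h1 := @hGR i j
    have h2 := @hHS i hi j
    simp only [Finset.mem_union, Finset.mem_inter, Finset.mem_sdiff] at *
    tauto
  · intro i hi hcS hcA
    have h2 := @hHS i hi c
    simp only [Finset.mem_union, Finset.mem_sdiff] at hcA h2
    rcases hcA with ⟨hcR, hcG⟩ | hcH
    · have : c ∈ R i \ S i := Finset.mem_sdiff.2 ⟨hcR, hcS⟩
      exact hcG (Finset.mem_filter.2 ⟨this, hFc ⟨i, c⟩ (Finset.mem_sigma.2 ⟨hi, this⟩) rfl⟩)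
    · exact hcS (h2 hcH).1
  · intro j hj
    have hFj := hF j hj
    rw [hFsrc, htgt F hFE, hEsrc, hEtgt] at hFj
    change (users.filter fun i => j ∈ G i).card ≤ (users.filter fun i => j ∈ H i).card ∧
      (users.filter fun i => j ∈ H i).card - (users.filter fun i => j ∈ G i).card ≤ _ at hFj
    have hA : (users.filter fun i => j ∈ (R i \ G i) ∪ H i) =
        ((users.filter fun i => j ∈ R i) \ (users.filter fun i => j ∈ G i)) ∪
          (users.filter fun i => j ∈ H i) := by
      ext i
      simp only [Finset.mem_union, Finset.mem_sdiff, Finset.mem_filter]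
      tauto
    have hGj : (users.filter fun i => j ∈ G i) ⊆ users.filter fun i => j ∈ R i :=
      Finset.monotone_filter_right _ fun i _ h => (Finset.mem_sdiff.1 (hGR i h)).1
    have hHj : Disjoint (users.filter fun i => j ∈ R i) (users.filter fun i => j ∈ H i) := by
      rw [Finset.disjoint_left]
      intro i h1 h2
      rw [Finset.mem_filter] at h1 h2
      exact (Finset.mem_sdiff.1 (hHS i h1.1 h2.2)).2 h1.2
    have key := Finset.card_sdiff_union_add_card hGj hHj
    rw [← hA] at key
    -- Users in both audiences cancel: the net inflow of `E` at `j` is the audience under `S` minus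
    -- that under `R`.
    have hRS : (users.filter fun i => j ∈ R i \ S i) =
        (users.filter fun i => j ∈ R i) \ (users.filter fun i => j ∈ S i) := by
      ext i
      simp only [Finset.mem_sdiff, Finset.mem_filter]
      tauto
    have hSR : (users.filter fun i => j ∈ S i \ R i) =
        (users.filter fun i => j ∈ S i) \ (users.filter fun i => j ∈ R i) := by
      ext i
      simp only [Finset.mem_sdiff, Finset.mem_filter]
      tauto
    rw [hRS, hSR] at hFj
    have e1 := Finset.card_sdiff_add_card_inter
      (users.filter fun i => j ∈ R i) (users.filter fun i => j ∈ S i)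
    have e2 := Finset.card_sdiff_add_card_inter
      (users.filter fun i => j ∈ S i) (users.filter fun i => j ∈ R i)
    rw [Finset.inter_comm] at e2
    dsimp only
    omega

/-! ### Values of `f` and exchange of stable sets -/

namespace Platform

variable {U C D : ℕ}

theorem pairEngagement_nonneg (P : Platform U C D) (i : Fin U) (j : Fin C) :
    0 ≤ P.pairEngagement i j := by
  rw [pairEngagement, PiLp.inner_apply]
  refine Finset.sum_nonneg fun d _ => ?_
  simpa using mul_nonneg (P.creatorType_nonneg j d) (P.userType_nonneg i d)

theorem effective_of_le (P : Platform U C D) {creators : Finset (Fin C)}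
    (h : P.K ≤ creators.card) : P.effective creators = P := if_pos h

theorem engagement_effective (P : Platform U C D) (users : Finset (Fin U))
    (creators : Finset (Fin C)) (R : Fin U → Finset (Fin C)) :
    (P.effective creators).engagement users R = P.engagement users R := by
  unfold effective
  split_ifs <;> rfl

theorem K_effective (P : Platform U C D) (creators : Finset (Fin C)) :
    (P.effective creators).K = min P.K creators.card := by
  unfold effective
  split_ifs with h
  · exact (min_eq_left h).symm
  · exact (min_eq_right (not_le.1 h).le).symm

/-- Engagements are nonnegative, so recommending everything is an upper bound, even beyond `K`
creators. -/
theorem f_le_engagement_const (P : Platform U C D) {users : Finset (Fin U)}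
    {creators : Finset (Fin C)} (h : P.IsWellDefined users creators) :
    P.f users creators ≤ P.engagement users fun _ => creators := by
  obtain ⟨R, hR, he⟩ := (P.f_isGreatest users creators h).1
  rw [he, engagement_effective]
  exact Finset.sum_le_sum fun i hi =>
    Finset.sum_le_sum_of_subset_of_nonneg (hR.subset i hi)
      fun j _ _ => P.pairEngagement_nonneg i j

theorem f_eq_engagement_const (P : Platform U C D) {users : Finset (Fin U)}
    {creators : Finset (Fin C)} (h : P.IsWellDefined users creators)
    (hK : creators.card ≤ P.K) :
    P.f users creators = P.engagement users fun _ => creators := by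
  obtain ⟨R, hR, he⟩ := (P.f_isGreatest users creators h).1
  rw [he, engagement_effective]
  refine Finset.sum_congr rfl fun i hi => ?_
  rw [Finset.eq_of_subset_of_card_le (hR.subset i hi)]
  rw [hR.card_eq i hi, K_effective, min_eq_right hK]

theorem engagement_const_union (P : Platform U C D) (users : Finset (Fin U))
    {X Y : Finset (Fin C)} (h : Disjoint X Y) :
    (P.engagement users fun _ => X ∪ Y) =
      (P.engagement users fun _ => X) + P.engagement users fun _ => Y := by
  simp only [engagement, Finset.sum_union h, Finset.sum_add_distrib]

theorem engagement_le_f (P : Platform U C D) {users : Finset (Fin U)}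
    {creators : Finset (Fin C)} {R : Fin U → Finset (Fin C)} (hK : P.K ≤ creators.card)
    (hR : P.IsStableSet users creators R) :
    P.engagement users R ≤ P.f users creators := by
  rw [← P.effective_of_le hK] at hR
  refine (P.f_isGreatest users creators ⟨R, hR⟩).2 ⟨R, hR, ?_⟩
  rw [engagement_effective]

/-- Stable sets on `creators ∪ {c₀, c₁}` and on `creators` can be rearranged into stable sets on
`creators ∪ {c₀}` and `creators ∪ {c₁}` with the same sum of engagements. -/
theorem IsStableSet.exists_exchange {P : Platform U C D} {users : Finset (Fin U)}
    {creators : Finset (Fin C)} {c₀ c₁ : Fin C} {R S : Fin U → Finset (Fin C)} (hne : c₀ ≠ c₁)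
    (hc₀ : c₀ ∉ creators) (hc₁ : c₁ ∉ creators)
    (hR : P.IsStableSet users (creators ∪ {c₀, c₁}) R) (hS : P.IsStableSet users creators S) :
    ∃ A B, P.IsStableSet users (creators ∪ {c₀}) A ∧ P.IsStableSet users (creators ∪ {c₁}) B ∧
      P.engagement users A + P.engagement users B =
        P.engagement users R + P.engagement users S := by
  obtain ⟨A, B, hA, hU, hI, hcA, hdeg⟩ := exists_alternating_exchange users R S
    (fun i hi => (hR.card_eq i hi).trans (hS.card_eq i hi).symm) c₁
  have hAsub : ∀ i ∈ users, A i ⊆ R i ∪ S i := fun i hi =>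
    Finset.subset_union_left.trans (hU i hi).subset
  have hBsub : ∀ i ∈ users, B i ⊆ R i ∪ S i := fun i hi =>
    Finset.subset_union_right.trans (hU i hi).subset
  have hRS : ∀ i ∈ users, R i ∪ S i ⊆ creators ∪ {c₀, c₁} := fun i hi =>
    Finset.union_subset (hR.subset i hi) ((hS.subset i hi).trans Finset.subset_union_left)
  have hhappy : ∀ i ∈ users, ∀ j ∈ R i ∪ S i, P.ebar ≤ P.pairEngagement i j := fun i hi j hj =>
    (Finset.mem_union.1 hj).elim (hR.happy i hi j) (hS.happy i hi j)
  have hc₁A : ∀ i ∈ users, c₁ ∉ A i := fun i hi =>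
    hcA i hi fun h => hc₁ (hS.subset i hi h)
  have hsum : ∀ j, (users.filter fun i => j ∈ A i).card + (users.filter fun i => j ∈ B i).card =
      (users.filter fun i => j ∈ R i).card + (users.filter fun i => j ∈ S i).card := by
    intro j
    rw [← Finset.card_union_add_card_inter (users.filter fun i => j ∈ A i),
      ← Finset.card_union_add_card_inter (users.filter fun i => j ∈ R i)]
    simp only [← Finset.filter_or, ← Finset.filter_and, ← Finset.mem_union, ← Finset.mem_inter]
    congr 2 <;> refine Finset.filter_congr fun i hi => ?_
    · rw [hU i hi]
    · rw [hI i hi]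
  have hS0 : ∀ j ∉ creators, (users.filter fun i => j ∈ S i).card = 0 := fun j hj =>
    Finset.card_eq_zero.2 (Finset.filter_eq_empty_iff.2 fun i hi h => hj (hS.subset i hi h))
  have hA1 : (users.filter fun i => c₁ ∈ A i).card = 0 :=
    Finset.card_eq_zero.2 (Finset.filter_eq_empty_iff.2 hc₁A)
  -- `S` never uses `c₀`, so both bounds in `hdeg` force `A` to keep the whole audience of `c₀`
  -- under `R`, leaving none for `B`.
  have hc₀B : ∀ i ∈ users, c₀ ∉ B i := by
    rw [← Finset.filter_eq_empty_iff, ← Finset.card_eq_zero]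
    have h1 := hsum c₀
    have h2 := hdeg c₀ hne
    have h3 := hS0 c₀ hc₀
    omega
  refine ⟨A, B, ⟨?_, ?_, ?_, ?_⟩, ⟨?_, ?_, ?_, ?_⟩, ?_⟩
  · intro i hi j hj
    have h1 := hRS i hi (hAsub i hi hj)
    have h2 : j ≠ c₁ := fun h => hc₁A i hi (h ▸ hj)
    simp only [Finset.mem_union, Finset.mem_insert, Finset.mem_singleton] at h1 ⊢
    tauto
  · exact fun i hi => (hA i hi).trans (hR.card_eq i hi)
  · exact fun i hi j hj => hhappy i hi j (hAsub i hi hj)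
  · intro j hj
    have h2 : j ≠ c₁ := by
      rintro rfl
      simp [hc₁, hne.symm] at hj
    refine (hR.audience j ?_).trans (hdeg j h2).1
    simp only [Finset.mem_union, Finset.mem_insert, Finset.mem_singleton] at hj ⊢
    tauto
  · intro i hi j hj
    have h1 := hRS i hi (hBsub i hi hj)
    have h2 : j ≠ c₀ := fun h => hc₀B i hi (h ▸ hj)
    simp only [Finset.mem_union, Finset.mem_insert, Finset.mem_singleton] at h1 ⊢
    tauto
  · intro i hi
    have h1 := Finset.card_union_add_card_inter (A i) (B i)
    rw [hU i hi, hI i hi, Finset.card_union_add_card_inter, hA i hi] at h1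
    have h2 := hS.card_eq i hi
    omega
  · exact fun i hi j hj => hhappy i hi j (hBsub i hi hj)
  · intro j hj
    have h1 := hsum j
    have hRj := hR.audience j (by
      simp only [Finset.mem_union, Finset.mem_insert, Finset.mem_singleton] at hj ⊢
      tauto)
    by_cases hjc : j = c₁
    · subst hjc
      omega
    -- The audience in `B` is at least the minimum of those in `R` and `S`.
    · have hSj := hS.audience j (by simpa [hjc] using hj)
      have h2 := hdeg j hjc
      omega
  · simp only [engagement, ← Finset.sum_add_distrib]
    refine Finset.sum_congr rfl fun i hi => ?_
    rw [← Finset.sum_union_inter, hU i hi, hI i hi, Finset.sum_union_inter]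

end Platform

/-! ### The submodularity inequality -/

theorem mainTheorem3 {U C D : ℕ} (P : Platform U C D) (hebar : P.ebar = 0)
    (users : Finset (Fin U)) (creators : Finset (Fin C)) (c₀ c₁ : Fin C)
    (hne : c₀ ≠ c₁) (hc₀ : c₀ ∉ creators) (hc₁ : c₁ ∉ creators)
    (hdef : P.IsWellDefined users creators)
    (hdef₀ : P.IsWellDefined users (creators ∪ {c₀}))
    (hdef₁ : P.IsWellDefined users (creators ∪ {c₁}))
    (hdef₀₁ : P.IsWellDefined users (creators ∪ {c₀, c₁})) :
    P.f users (creators ∪ {c₀, c₁}) - P.f users (creators ∪ {c₁}) ≤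
      P.f users (creators ∪ {c₀}) - P.f users creators := by

  rcases le_or_gt P.K creators.card with hK | hK
  · have hK' : ∀ X, P.K ≤ (creators ∪ X).card := fun X =>
      hK.trans (Finset.card_le_card Finset.subset_union_left)
    obtain ⟨R, hR, hRe⟩ := (P.f_isGreatest users _ hdef₀₁).1
    obtain ⟨S, hS, hSe⟩ := (P.f_isGreatest users _ hdef).1
    rw [P.effective_of_le (hK' _)] at hR hRe
    rw [P.effective_of_le hK] at hS hSe
    obtain ⟨A, B, hA, hB, hAB⟩ := hR.exists_exchange hne hc₀ hc₁ hS
    have h1 := P.engagement_le_f (hK' _) hA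
    have h2 := P.engagement_le_f (hK' _) hB
    linarith
  · have hd : ∀ c ∉ creators, Disjoint creators {c} := fun c hc =>
      Finset.disjoint_singleton_right.2 hc
    have hcard : ∀ c, (creators ∪ {c}).card ≤ P.K := fun c =>
      (Finset.card_union_le _ _).trans (by simpa using hK)
    -- `creators ∪ {c₀, c₁}` may have `K + 1` elements, so only this upper bound holds; the other
    -- three values are exact.
    have h01 := P.f_le_engagement_const hdef₀₁
    have hdisj : Disjoint (creators ∪ {c₀}) {c₁} := by
      simp [hc₁, hne.symm]
    rw [Finset.insert_eq c₀ {c₁}, ← Finset.union_assoc, P.engagement_const_union users hdisj,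
      P.engagement_const_union users (hd c₀ hc₀)] at h01
    rw [Finset.insert_eq c₀ {c₁}, ← Finset.union_assoc, P.f_eq_engagement_const hdef hK.le,
      P.f_eq_engagement_const hdef₀ (hcard c₀), P.f_eq_engagement_const hdef₁ (hcard c₁),
      P.engagement_const_union users (hd c₀ hc₀), P.engagement_const_union users (hd c₁ hc₁)]
    linarith
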